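/- Let $V_5$ be a $5$-dimensional complex vector space with a volume form $\mathrm{vol}:\bigwedge^5V_5\xrightarrow{\sim}\mathbb{C}$, let $W\subset\bigwedge^2V_5$ be a $7$-dimensional linear subspace, and let $Q\subset\mathbb{P}(W)$ be the quadric $\gamma(w,w)=0$ defined by a symmetric bilinear form $\gamma$ on $W$. For $v\in V_5$ let $P_v(w,w')=\mathrm{vol}(v\wedge w\wedge w')$. Consider the subschemes $$M_S=\mathbb{P}(W)\cap G(2,V_5)=\bigcap_{v\in V_5}\{P_v|_W=0\},\qquad S=\mathbb{P}(W)\cap G(2,V_5)\cap Q$$ of $\mathbb{P}(W)$. Assume that $S$ is strongly smooth, i.e. that $M_S$ and $S$ are dimensionally transverse intersections (of dimension $3$ and $2$ respectively at each of their points) and are both smooth; $S$ is then a K3 surface. Let $V_6=V_5\oplus\mathbb{C}x$. The Lagrangian subspace associated to $S$ is $$A(S)=\Big\{\eta+x\wedge w\;\Big|\;\eta\in\textstyle\bigwedge^3V_5,\ w\in W,\ \mathrm{vol}(\eta\wedge w')=-\gamma(w,w')\text{ for all }w'\in W\Big\}\subset\textstyle\bigwedge^3V_6 .$$ For $v\in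 V_6\setminus\{0\}$ put $F_v=v\wedge\bigwedge^2V_6$, and let $Y^3_{A(S)}=\{[v]\in\mathbb{P}(V_6)\mid\dim(F_v\cap A(S))=3\}$. Then the set of points of $Y^3_{A(S)}\cap\mathbb{P}(V_5)$ is in bijection with the set of lines of $\mathbb{P}(W)$ contained in $S$: $$|Y^3_{A(S)}\cap\mathbb{P}(V_5)|=|\{\ell\subset S\mid\ell\text{ a line}\}| .$$ In particular, if $S$ contains no line, then $Y^3_{A(S)}\cap\mathbb{P}(V_5)=\emptyset$. -/

import Mathlib

open scoped LinearAlgebra.Projectivization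

noncomputable section

namespace GushelMukai

/-! ### Wedge products between exterior powers -/

section Wedge

variable {M : Type*} [AddCommGroup M] [Module ℂ M]

/-- The wedge product `⋀ⁱ M × ⋀ʲ M → ⋀ⁱ⁺ʲ M`, as a bilinear map. -/
def wedge (i j : ℕ) : ⋀[ℂ]^i M →ₗ[ℂ] ⋀[ℂ]^j M →ₗ[ℂ] ⋀[ℂ]^(i + j) M :=
  LinearMap.mk₂ ℂ
    (fun a b => ⟨(a : ExteriorAlgebra ℂ M) * (b : ExteriorAlgebra ℂ M),
      SetLike.mul_mem_graded a.2 b.2⟩)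
    (fun a a' b => Subtype.ext (by simp [add_mul]))
    (fun c a b => Subtype.ext (by simp))
    (fun a b b' => Subtype.ext (by simp [mul_add]))
    (fun c a b => Subtype.ext (by simp))

/-- A vector of `M`, seen in `⋀¹ M`. -/
def vec : M →ₗ[ℂ] ⋀[ℂ]^1 M :=
  (ExteriorAlgebra.ι ℂ).codRestrict (⋀[ℂ]^1 M) (fun v => by
    simp [ExteriorAlgebra.exteriorPower])

/-- `F_v = v ∧ ⋀² M`, a linear subspace of `⋀³ M`. -/
def wedgeFiber (v : M) : Submodule ℂ (⋀[ℂ]^3 M) :=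
  LinearMap.range (wedge 1 2 (vec v))

/-- The stratum `Y^k_A = {[v] ∈ ℙ(M) | dim (F_v ∩ A) = k}`. Here `F_v` only depends on `[v]`. -/
def epwStratum (A : Submodule ℂ (⋀[ℂ]^3 M)) (k : ℕ) : Set (ℙ ℂ M) :=
  {p | Module.finrank ℂ ↥(wedgeFiber p.rep ⊓ A) = k}

end Wedge

/-! ### Intersections of quadrics in a projective space

A family `b` of symmetric bilinear forms on `W` defines the closed subscheme of `ℙ(W)` with
equations `b i (w, w) = 0`. It is handled through its affine cone in `W`. -/

section Quadrics

variable {W : Type*} [AddCommMonoid W] [Module ℂ W] {ι : Type*}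

/-- The affine cone in `W` over the intersection of the quadrics `b i (w, w) = 0`. -/
def quadricCone (b : ι → LinearMap.BilinForm ℂ W) : Set W :=
  {w | ∀ i, b i w w = 0}

/-- The tangent space at `p` to the affine cone over the scheme `{b i (w, w) = 0 for all i}`:
the common kernel of the differentials at `p` of its equations, which are `2 • b i p` as the `b i`
are symmetric. The Zariski tangent space of the projective scheme at `[p]` is the quotient
of this space by the line `ℂ p`. -/
def coneTangent (b : ι → LinearMap.BilinForm ℂ W) (p : W) : Submodule ℂ W :=
  ⨅ i, LinearMap.ker (b i p)

/-- The ring of regular functions on a subset `X` of `W` (used for affine cones): the functions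
that are polynomials in linear forms. -/
def regularFunctions (X : Set W) : Subalgebra ℂ (X → ℂ) :=
  Algebra.adjoin ℂ (Set.range fun (l : Module.Dual ℂ W) (x : X) => l x)

/-- The maximal ideal of the regular functions vanishing at the point `p`. -/
def pointIdeal (X : Set W) (p : X) : Ideal (regularFunctions X) :=
  RingHom.ker ((Pi.evalRingHom (fun _ : X => ℂ) p).comp (regularFunctions X).val.toRingHom)

/-- The local dimension at `p` of the affine set `X`: the height of the maximal ideal of `p`. If
`X` is the affine cone over a projective variety `Z` and `p ≠ 0`, it equals `dim_[p] Z + 1`. -/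
def localDim (X : Set W) (p : X) : ℕ∞ := (pointIdeal X p).height

/-- The subscheme of `ℙ(W)` defined by the quadrics `b` has dimension `n` at each of its closed
points. -/
def HasPureDimension (b : ι → LinearMap.BilinForm ℂ W) (n : ℕ) : Prop :=
  ∀ p : quadricCone b, (p : W) ≠ 0 → localDim (quadricCone b) p = n + 1

/-- The subscheme of `ℙ(W)` defined by the quadrics `b` is smooth: at each closed point, the
dimension of its Zariski tangent space is its local dimension (both are increased by one here, as
they are computed on the affine cone). -/
def IsSmooth (b : ι → LinearMap.BilinForm ℂ W) : Prop :=
  ∀ p : quadricCone b, (p : W) ≠ 0 →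
    (Module.finrank ℂ (coneTangent b (p : W)) : ℕ∞) = localDim (quadricCone b) p

/-- The lines contained in the projective variety `ℙ{w | b i (w, w) = 0}`, given as planes of
`W`. -/
def linesIn (b : ι → LinearMap.BilinForm ℂ W) : Set (Submodule ℂ W) :=
  {L | Module.finrank ℂ L = 2 ∧ ∀ w ∈ L, w ∈ quadricCone b}

end Quadrics

/-! ### Ordinary Gushel–Mukai intersections and their Lagrangian subspaces -/

section GM

variable {V : Type*} [AddCommGroup V] [Module ℂ V] (vol : ⋀[ℂ]^5 V ≃ₗ[ℂ] ℂ)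
  (W : Submodule ℂ (⋀[ℂ]^2 V))

/-- The Pfaffian quadrics `P_v (w, w') = vol (v ∧ w ∧ w')`, restricted to `W ⊆ ⋀² V`. They cut out
the Grassmannian hull `ℙ(W) ∩ G(2, V)`. -/
def pfaffian (v : V) : LinearMap.BilinForm ℂ W :=
  LinearMap.mk₂ ℂ
    (fun w w' : W => vol (wedge 1 4 (vec v) (wedge 2 2 (w : ⋀[ℂ]^2 V) (w' : ⋀[ℂ]^2 V))))
    (fun a a' b => by simp)
    (fun c a b => by simp)
    (fun a b b' => by simp)
    (fun c a b => by simp)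

/-- The linear system `q : V₆ = V ⊕ ℂ → S² W^∨` of the quadrics containing
`ℙ(W) ∩ G(2, V) ∩ Q`, where `Q` has equation `γ`: `q (v, c) = P_v + c γ`. The intersection of all
these quadrics is `ℙ(W) ∩ G(2, V) ∩ Q`. -/
def gmQuadrics (γ : LinearMap.BilinForm ℂ W) (x : V × ℂ) : LinearMap.BilinForm ℂ W :=
  pfaffian vol W x.1 + x.2 • γ

/-- The ordinary Gushel–Mukai intersection `Z = ℙ(W) ∩ G(2, V) ∩ Q` is strongly smooth of
dimension `n`: `dim W = n + 5`, and both the Grassmannian hull `ℙ(W) ∩ G(2, V)` and `Z` are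
dimensionally transverse (of the expected dimensions `n + 1` and `n` everywhere) and smooth. -/
structure IsStronglySmooth (γ : LinearMap.BilinForm ℂ W) (n : ℕ) : Prop where
  finrank_eq : Module.finrank ℂ W = n + 5
  hull_dim : HasPureDimension (pfaffian vol W) (n + 1)
  hull_smooth : IsSmooth (pfaffian vol W)
  dim : HasPureDimension (gmQuadrics vol W γ) n
  smooth : IsSmooth (gmQuadrics vol W γ)

/-- The map `⋀³ V ⊕ ⋀² V → ⋀³ (V ⊕ ℂ)`, `(η, w) ↦ η + x ∧ w`, where `x = (0, 1)`. -/
def glue : (⋀[ℂ]^3 V × ⋀[ℂ]^2 V) →ₗ[ℂ] ⋀[ℂ]^3 (V × ℂ) :=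
  (exteriorPower.map 3 (LinearMap.inl ℂ V ℂ)).coprod
    ((wedge 1 2 (vec ((0, 1) : V × ℂ))).comp (exteriorPower.map 2 (LinearMap.inl ℂ V ℂ)))

/-- The pairs `(η, w)` with `η ∈ ⋀³ V`, `w ∈ W` and `vol (η ∧ w') = - γ (w, w')` for all
`w' ∈ W`. -/
def lagrangianPairs (γ : LinearMap.BilinForm ℂ W) : Submodule ℂ (⋀[ℂ]^3 V × W) where
  carrier := {a | ∀ w' : W, vol (wedge 3 2 a.1 (w' : ⋀[ℂ]^2 V)) = - γ a.2 w'}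
  add_mem' := by
    intro a b ha hb w'
    have h1 := ha w'
    have h2 := hb w'
    simp only [Prod.fst_add, Prod.snd_add, map_add, LinearMap.add_apply, h1, h2]
    ring
  zero_mem' := by
    intro w'
    simp
  smul_mem' := by
    intro c a ha w'
    have h1 := ha w'
    simp only [Prod.smul_fst, Prod.smul_snd, map_smul, LinearMap.smul_apply, h1, smul_neg]

/-- The Lagrangian subspace `A(Z) ⊆ ⋀³ (V ⊕ ℂ)` associated to `Z = ℙ(W) ∩ G(2, V) ∩ Q`: the
vectors `η + x ∧ w` with `η ∈ ⋀³ V`, `w ∈ W` and `vol (η ∧ w') = - γ (w, w')` for all `w' ∈ W`. -/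
def lagrangian (γ : LinearMap.BilinForm ℂ W) : Submodule ℂ (⋀[ℂ]^3 (V × ℂ)) :=
  (lagrangianPairs vol W γ).map (glue ∘ₗ LinearMap.prodMap LinearMap.id W.subtype)

end GM

/-- The hyperplane `ℙ(V) ⊆ ℙ(V ⊕ ℂ)`. -/
def hyperplane (V : Type*) [AddCommGroup V] [Module ℂ V] : Set (ℙ ℂ (V × ℂ)) :=
  {p | p.submodule ≤ LinearMap.range (LinearMap.inl ℂ V ℂ)}

end GushelMukai

end

noncomputable section

namespace GushelMukai

open ExteriorAlgebra Module CliffordAlgebra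

/-! ### Exterior algebra: contractions, Koszul exactness, decomposable vectors. -/

section Exterior

variable {V : Type*} [AddCommGroup V] [Module ℂ V]

/-! For `v ≠ 0` in `V`, let `L_v` be the space of `w ∈ W` with `v ∧ w = 0` (`lineSpace`), of
dimension `l`. An element `η + x ∧ w` of `A(S)` lies in `F_v` iff `v ∧ η = 0` and `w ∈ L_v`. Project
such elements to `w`. The forms `vol(η ∧ ·)` on `W` with `v ∧ η = 0` fill the annihilator of `L_v`
(`range_fiberDual`). Hence the image of the projection is the radical of `γ` restricted to `L_v`,
and the kernel has dimension `6 - (7 - l) = l - 1`. With `r` the dimension of the radical, `dim(F_v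
∩ A(S)) = r + l - 1`.

Smoothness of the hull `M_S` forces `l ≤ 2` (`finrank_lineSpace_le`). If `l ≥ 3`, at least a pencil
of 3-vectors `v ∧ α` annihilates `W`, and it contains a decomposable one `ξ = v ∧ a ∧ b`. The planes
of `⟨v, a, b⟩` form a 3-dimensional space of decomposable vectors in the 9-dimensional hyperplane
`ξ^⊥`, so it meets the 7-dimensional `W ⊆ ξ^⊥` in some `p ≠ 0`. The 7-dimensional tangent space to
the cone over `G(2, V)` at `p` also lies in `ξ^⊥`, so it meets `W` in dimension at least 5, whereas
a smooth threefold allows only 4.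

Since `r ≤ l ≤ 2`, the dimension is 3 iff `l = 2` and `γ` vanishes on `L_v`, that is, iff `ℙ(L_v)`
is a line in `S`. Every line in `S` arises so, because the planes parametrized by a line of `G(2,
V)` share a vector `v` (`exists_common_factor`). The point `[v]` is unique because `L_v ∩ L_v'` lies
in `ℂ (v ∧ v')` for independent `v`, `v'`. -/

theorem exteriorPower_succ_induction {n : ℕ} {p : ExteriorAlgebra ℂ V → Prop}
    (hmul : ∀ v : V, ∀ y ∈ ⋀[ℂ]^n V, p (ι ℂ v * y)) (hadd : ∀ x y, p x → p y → p (x + y))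
    {x : ExteriorAlgebra ℂ V} (hx : x ∈ ⋀[ℂ]^(n + 1) V) : p x := by
  rw [exteriorPower, pow_succ'] at hx
  refine Submodule.mul_induction_on hx ?_ hadd
  rintro _ ⟨v, rfl⟩ y hy
  exact hmul v y hy

theorem mem_exteriorPower_zero {x : ExteriorAlgebra ℂ V} (hx : x ∈ ⋀[ℂ]^0 V) :
    ∃ c : ℂ, x = algebraMap ℂ _ c := by
  rw [exteriorPower, pow_zero] at hx
  obtain ⟨c, hc⟩ := Submodule.mem_one.1 hx
  exact ⟨c, hc.symm⟩

theorem ι_mem_exteriorPower_one (v : V) : ι ℂ v ∈ ⋀[ℂ]^1 V := (vec v).2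

theorem mem_exteriorPower_one {x : ExteriorAlgebra ℂ V} (hx : x ∈ ⋀[ℂ]^1 V) :
    ∃ v, x = ι ℂ v := by
  rw [exteriorPower, pow_one] at hx
  obtain ⟨v, hv⟩ := hx
  exact ⟨v, hv.symm⟩

theorem mul_mem_exteriorPower {i j : ℕ} {x y : ExteriorAlgebra ℂ V} (hx : x ∈ ⋀[ℂ]^i V)
    (hy : y ∈ ⋀[ℂ]^j V) : x * y ∈ ⋀[ℂ]^(i + j) V :=
  SetLike.mul_mem_graded hx hy

theorem ι_mul_mem_exteriorPower {n : ℕ} (v : V) {y : ExteriorAlgebra ℂ V}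
    (hy : y ∈ ⋀[ℂ]^n V) : ι ℂ v * y ∈ ⋀[ℂ]^(n + 1) V := by
  rw [add_comm]
  exact mul_mem_exteriorPower (ι_mem_exteriorPower_one v) hy

theorem ι_mul_ι_mul_self (v : V) (x : ExteriorAlgebra ℂ V) : ι ℂ v * (ι ℂ v * x) = 0 := by
  rw [← mul_assoc, ι_sq_zero, zero_mul]

theorem ι_mul_ι_swap (a b : V) : ι ℂ a * ι ℂ b = - (ι ℂ b * ι ℂ a) :=
  eq_neg_of_add_eq_zero_left (ι_add_mul_swap a b)

theorem ι_mul_ι_mul_swap (a b : V) (x : ExteriorAlgebra ℂ V) :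
    ι ℂ a * (ι ℂ b * x) = - (ι ℂ b * (ι ℂ a * x)) := by
  rw [← mul_assoc, ι_mul_ι_swap, neg_mul, mul_assoc]

/-- The contraction of the exterior algebra by a linear form. -/
def contr (d : Dual ℂ V) : ExteriorAlgebra ℂ V →ₗ[ℂ] ExteriorAlgebra ℂ V :=
  contractLeft d

theorem contr_ι_mul (d : Dual ℂ V) (a : V) (x : ExteriorAlgebra ℂ V) :
    contr d (ι ℂ a * x) = d a • x - ι ℂ a * contr d x :=
  contractLeft_ι_mul d a x

theorem contr_algebraMap (d : Dual ℂ V) (c : ℂ) :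
    contr d (algebraMap ℂ (ExteriorAlgebra ℂ V) c) = 0 :=
  contractLeft_algebraMap _ d c

theorem contr_ι (d : Dual ℂ V) (a : V) : contr d (ι ℂ a) = algebraMap ℂ _ (d a) :=
  contractLeft_ι _ d a

theorem contr_contr (d : Dual ℂ V) (x : ExteriorAlgebra ℂ V) : contr d (contr d x) = 0 :=
  contractLeft_contractLeft d x

theorem contr_mem {n : ℕ} (d : Dual ℂ V) {x : ExteriorAlgebra ℂ V} (hx : x ∈ ⋀[ℂ]^(n + 1) V) :
    contr d x ∈ ⋀[ℂ]^n V := by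
  induction n generalizing x with
  | zero =>
    obtain ⟨v, rfl⟩ := mem_exteriorPower_one hx
    rw [contr_ι, exteriorPower, pow_zero]
    exact Submodule.algebraMap_mem _
  | succ n ih =>
    refine exteriorPower_succ_induction (p := fun x => contr d x ∈ ⋀[ℂ]^(n + 1) V) (fun v y hy => ?_) (fun x y hx hy => ?_) hx
    · rw [contr_ι_mul]
      exact sub_mem (Submodule.smul_mem _ _ hy) (ι_mul_mem_exteriorPower v (ih hy))
    · rw [map_add]
      exact add_mem hx hy

theorem ι_mul_comm_sign {n : ℕ} (v : V) {x : ExteriorAlgebra ℂ V} (hx : x ∈ ⋀[ℂ]^n V) :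
    ι ℂ v * x = (-1 : ℂ) ^ n • (x * ι ℂ v) := by
  induction n generalizing x with
  | zero =>
    obtain ⟨c, rfl⟩ := mem_exteriorPower_zero hx
    rw [pow_zero, one_smul, Algebra.commutes]
  | succ n ih =>
    refine exteriorPower_succ_induction (p := fun x => ι ℂ v * x = (-1 : ℂ) ^ (n + 1) • (x * ι ℂ v)) (fun u y hy => ?_) (fun x y hx hy => ?_) hx
    · rw [ι_mul_ι_mul_swap, ih hy, mul_assoc, mul_smul_comm, pow_succ, mul_neg_one, neg_smul]
    · rw [mul_add, add_mul, smul_add, hx, hy]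

theorem mul_comm_of_mem_two {a : ExteriorAlgebra ℂ V} (ha : a ∈ ⋀[ℂ]^2 V)
    (x : ExteriorAlgebra ℂ V) : a * x = x * a := by
  induction x using CliffordAlgebra.induction with
  | algebraMap r => rw [Algebra.commutes]
  | ι v =>
    have := ι_mul_comm_sign v ha
    simp only [even_two, Even.neg_pow, one_pow, one_smul] at this
    exact this.symm
  | mul x y hx hy => rw [← mul_assoc, hx, mul_assoc, hy, mul_assoc]
  | add x y hx hy => rw [mul_add, add_mul, hx, hy]

/-- Exactness of the Koszul complex. -/
theorem exists_eq_ι_mul {n : ℕ} {v : V} (hv : v ≠ 0) {x : ExteriorAlgebra ℂ V}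
    (hx : x ∈ ⋀[ℂ]^(n + 1) V) (h : ι ℂ v * x = 0) : ∃ y ∈ ⋀[ℂ]^n V, x = ι ℂ v * y := by
  obtain ⟨d, hd⟩ := Projective.exists_dual_eq_one ℂ hv
  -- As `d v = 1`, contraction by `d` is a contracting homotopy for `v ∧ ·`.
  refine ⟨contr d x, contr_mem d hx, ?_⟩
  have h1 := congrArg (contr d) h
  rwa [contr_ι_mul, hd, one_smul, map_zero, sub_eq_zero] at h1

theorem exists_eq_ι_mul' {v : V} (hv : v ≠ 0) {x : ExteriorAlgebra ℂ V}
    (hx : x ∈ ⋀[ℂ]^2 V) (h : ι ℂ v * x = 0) : ∃ u, x = ι ℂ v * ι ℂ u := by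
  obtain ⟨y, hy, rfl⟩ := exists_eq_ι_mul hv hx h
  obtain ⟨u, rfl⟩ := mem_exteriorPower_one hy
  exact ⟨u, rfl⟩

/-- Euler's identity. In characteristic zero it makes contractions detect nonzero elements of
positive degree. -/
theorem sum_ι_mul_contr {I : Type*} [Fintype I] (b : Basis I ℂ V) {n : ℕ}
    {x : ExteriorAlgebra ℂ V} (hx : x ∈ ⋀[ℂ]^n V) :
    ∑ i, ι ℂ (b i) * contr (b.coord i) x = (n : ℂ) • x := by
  induction n generalizing x with
  | zero =>
    obtain ⟨c, rfl⟩ := mem_exteriorPower_zero hx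
    simp [contr_algebraMap]
  | succ n ih =>
    refine exteriorPower_succ_induction (p := fun x =>
      ∑ i, ι ℂ (b i) * contr (b.coord i) x = ((n + 1 : ℕ) : ℂ) • x) (fun u y hy => ?_) (fun x y hx hy => ?_) hx
    · have h1 : ∑ i, ι ℂ (b i) * (b.coord i u • y) = ι ℂ u * y := by
        conv_rhs => rw [← b.sum_repr u, map_sum, Finset.sum_mul]
        simp
      have h2 : ∑ i, ι ℂ (b i) * (ι ℂ u * contr (b.coord i) y) = - (ι ℂ u * ((n : ℂ) • y)) := by
        rw [← ih hy, Finset.mul_sum, ← Finset.sum_neg_distrib]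
        exact Finset.sum_congr rfl fun i _ => ι_mul_ι_mul_swap _ _ _
      simp only [contr_ι_mul, mul_sub, Finset.sum_sub_distrib, h1, h2]
      rw [mul_smul_comm, sub_neg_eq_add, Nat.cast_succ, add_smul, one_smul, add_comm]
    · simp only [map_add, mul_add, Finset.sum_add_distrib, hx, hy, smul_add]

theorem exists_contr_ne_zero [FiniteDimensional ℂ V] {n : ℕ} {x : ExteriorAlgebra ℂ V}
    (hx : x ∈ ⋀[ℂ]^(n + 1) V) (h0 : x ≠ 0) : ∃ d, contr d x ≠ 0 := by
  by_contra! h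
  have := sum_ι_mul_contr (finBasis ℂ V) hx
  simp only [h, mul_zero, Finset.sum_const_zero] at this
  exact (smul_ne_zero (Nat.cast_ne_zero.2 n.succ_ne_zero) h0) this.symm

/-- Contracting `e_i ∧ x = 0` shows that every term of Euler's sum equals `x`, so `dim V • x = n •
x`. -/
theorem eq_zero_of_ι_mul [FiniteDimensional ℂ V] {n : ℕ} (hn : n < finrank ℂ V)
    {x : ExteriorAlgebra ℂ V} (hx : x ∈ ⋀[ℂ]^n V) (h : ∀ v, ι ℂ v * x = 0) : x = 0 := by
  have h1 := sum_ι_mul_contr (finBasis ℂ V) hx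
  have h2 : ∀ i, ι ℂ (finBasis ℂ V i) * contr ((finBasis ℂ V).coord i) x = x := by
    intro i
    have := congrArg (contr ((finBasis ℂ V).coord i)) (h (finBasis ℂ V i))
    rw [contr_ι_mul, map_zero] at this
    simpa using (sub_eq_zero.1 this).symm
  simp only [h2, Finset.sum_const, Finset.card_univ, Fintype.card_fin] at h1
  rw [← Nat.cast_smul_eq_nsmul ℂ, ← sub_eq_zero, ← sub_smul] at h1
  refine (smul_eq_zero.1 h1).resolve_left (sub_ne_zero.2 ?_)
  exact_mod_cast hn.ne'

/-- Nondegeneracy of the wedge pairing in complementary degrees, peeling off one vector of `y` at a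
time. -/
theorem eq_zero_of_mul_eq_zero [FiniteDimensional ℂ V] {n k : ℕ} (hn : k + n = finrank ℂ V)
    {x : ExteriorAlgebra ℂ V} (hx : x ∈ ⋀[ℂ]^n V) (h : ∀ y ∈ ⋀[ℂ]^k V, y * x = 0) : x = 0 := by
  induction k generalizing n x with
  | zero => simpa using h 1 (by rw [exteriorPower, pow_zero]; exact Submodule.one_le.1 le_rfl)
  | succ k ih =>
    refine eq_zero_of_ι_mul (by omega) hx fun v => ?_
    refine ih (n := n + 1) (by omega) (ι_mul_mem_exteriorPower v hx) fun y hy => ?_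
    rw [← mul_assoc]
    exact h _ (mul_mem_exteriorPower hy (ι_mem_exteriorPower_one v))

theorem contr_mul_of_mem_two (d : Dual ℂ V) {a : ExteriorAlgebra ℂ V} (ha : a ∈ ⋀[ℂ]^2 V)
    (x : ExteriorAlgebra ℂ V) : contr d (a * x) = contr d a * x + a * contr d x := by
  refine exteriorPower_succ_induction (p := fun a =>
    contr d (a * x) = contr d a * x + a * contr d x) (fun u y hy => ?_) (fun a b ha hb => ?_) ha
  · obtain ⟨v, rfl⟩ := mem_exteriorPower_one hy
    simp only [mul_assoc, contr_ι_mul, contr_ι, mul_sub, sub_mul, smul_mul_assoc, mul_smul_comm,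
      Algebra.algebraMap_eq_smul_one, mul_one]
    abel
  · simp only [add_mul, map_add, ha, hb]
    abel

/-- Contracting `w ∧ w = 0` by `d` gives `2 u ∧ w = 0`, where the vector `u` is the contraction of
`w`. If `u ≠ 0`, Koszul exactness divides `w` by `u`. -/
theorem exists_eq_ι_mul_ι [FiniteDimensional ℂ V] {w : ExteriorAlgebra ℂ V}
    (hw : w ∈ ⋀[ℂ]^2 V) (h : w * w = 0) : ∃ a b, w = ι ℂ a * ι ℂ b := by
  by_cases h0 : w = 0
  · exact ⟨0, 0, by simp [h0]⟩
  obtain ⟨d, hd⟩ := exists_contr_ne_zero hw h0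
  obtain ⟨u, hu⟩ := mem_exteriorPower_one (contr_mem d hw)
  have h1 := congrArg (contr d) h
  rw [contr_mul_of_mem_two d hw, mul_comm_of_mem_two hw, map_zero, ← two_smul ℂ, hu] at h1
  have h2 := (smul_eq_zero.1 h1).resolve_left two_ne_zero
  obtain ⟨b, hb⟩ := exists_eq_ι_mul' (by rintro rfl; simp [hu] at hd) hw h2
  exact ⟨u, b, hb⟩

/-- Modulo `v`, replace `α` by a representative `β` killed by a contraction `d` with `d v = 1`. Then
`d` also kills `β ∧ β`, so `v ∧ β ∧ β = 0` forces `β ∧ β = 0` and `β` is decomposable. -/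
theorem exists_ι_mul_eq [FiniteDimensional ℂ V] {v : V} (hv : v ≠ 0) {α : ExteriorAlgebra ℂ V}
    (hα : α ∈ ⋀[ℂ]^2 V) (h : ι ℂ v * (α * α) = 0) :
    ∃ a b, ι ℂ v * α = ι ℂ v * (ι ℂ a * ι ℂ b) := by
  obtain ⟨d, hd⟩ := Projective.exists_dual_eq_one ℂ hv
  set β := contr d (ι ℂ v * α) with hβ
  have hβ2 : β ∈ ⋀[ℂ]^2 V := contr_mem d (ι_mul_mem_exteriorPower v hα)
  have hβα : β = α - ι ℂ v * contr d α := by rw [hβ, contr_ι_mul, hd, one_smul]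
  have h1 : ι ℂ v * β = ι ℂ v * α := by rw [hβα, mul_sub, ι_mul_ι_mul_self, sub_zero]
  have h2 : ι ℂ v * (β * β) = 0 := by
    rw [← mul_assoc, h1, mul_assoc, ← mul_comm_of_mem_two hβ2, ← mul_assoc, h1, mul_assoc, h]
  have h3 : contr d (β * β) = 0 := by
    rw [contr_mul_of_mem_two d hβ2, hβ, contr_contr, zero_mul, mul_zero, add_zero]
  have h4 := congrArg (contr d) h2
  rw [contr_ι_mul, h3, hd, one_smul, mul_zero, sub_zero, map_zero] at h4
  obtain ⟨a, b, hab⟩ := exists_eq_ι_mul_ι hβ2 h4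
  exact ⟨a, b, by rw [← h1, hab]⟩

theorem exists_dual_family {I : Type*} [DecidableEq I] {v : I → V} (hv : LinearIndependent ℂ v) :
    ∃ f : I → Dual ℂ V, ∀ j i, f j (v i) = if j = i then 1 else 0 := by
  have hf : ∀ j, ∃ f : Dual ℂ V, ∀ i, f (v i) = if j = i then 1 else 0 := by
    intro j
    obtain ⟨f, hf⟩ := ((Basis.span hv).coord j).exists_extend
    refine ⟨f, fun i => ?_⟩
    have h1 := LinearMap.congr_fun hf (Basis.span hv i)
    rw [Basis.coord_apply, Basis.repr_self, Finsupp.single_apply] at h1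
    simpa [Basis.span_apply, eq_comm] using h1
  choose f hf using hf
  exact ⟨f, hf⟩

theorem ιMulti_ne_zero {n : ℕ} {v : Fin n → V} (hv : LinearIndependent ℂ v) :
    ExteriorAlgebra.ιMulti ℂ n v ≠ 0 := by
  obtain ⟨f, hf⟩ := exists_dual_family hv
  intro h
  have h1 : exteriorPower.ιMulti ℂ n v = 0 := Subtype.ext h
  have h2 := exteriorPower.pairingDual_ιMulti_ιMulti f v
  rw [h1, map_zero] at h2
  have h3 : (Matrix.of fun i j => f j (v i)) = (1 : Matrix (Fin n) (Fin n) ℂ) := by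
    ext i j
    simp [hf, Matrix.one_apply, eq_comm]
  rw [h3, Matrix.det_one] at h2
  exact zero_ne_one h2

/-- If `a ∧ b ∧ c ∧ d = 0`, the planes `⟨a, b⟩` and `⟨c, d⟩` meet. A dependence relation, split into
its two halves, exhibits a common vector, nonzero because each plane is genuinely 2-dimensional. -/
theorem exists_common_factor [FiniteDimensional ℂ V] {w₁ w₂ : ExteriorAlgebra ℂ V}
    (hw₁ : w₁ ∈ ⋀[ℂ]^2 V) (hw₂ : w₂ ∈ ⋀[ℂ]^2 V) (h₁ : w₁ * w₁ = 0) (h₂ : w₂ * w₂ = 0)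
    (h₁₂ : w₁ * w₂ = 0) (h0 : w₁ ≠ 0) (h0' : w₂ ≠ 0) :
    ∃ v, v ≠ 0 ∧ ι ℂ v * w₁ = 0 ∧ ι ℂ v * w₂ = 0 := by
  obtain ⟨a, b, rfl⟩ := exists_eq_ι_mul_ι hw₁ h₁
  obtain ⟨c, d, rfl⟩ := exists_eq_ι_mul_ι hw₂ h₂
  have hdep : ¬ LinearIndependent ℂ ![a, b, c, d] := by
    intro h
    apply ιMulti_ne_zero h
    simpa [ιMulti_apply, mul_assoc] using h₁₂
  rw [Fintype.not_linearIndependent_iff] at hdep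
  obtain ⟨g, hg, i, hi⟩ := hdep
  simp only [Fin.sum_univ_four, Matrix.cons_val] at hg
  have key : g 0 • a + g 1 • b = - (g 2 • c + g 3 • d) := by
    rw [eq_neg_iff_add_eq_zero, ← hg]; abel
  have aux : ∀ (s t : ℂ) (x y : V), ι ℂ (s • x + t • y) * (ι ℂ x * ι ℂ y) = 0 := by
    intro s t x y
    rw [map_add, map_smul, map_smul, add_mul, smul_mul_assoc, smul_mul_assoc, ι_mul_ι_mul_self,
      ι_mul_ι_mul_swap, ι_sq_zero, mul_zero, neg_zero, smul_zero, smul_zero, add_zero]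
  have aux' : ∀ (s t : ℂ) (x y : V), ι ℂ x * ι ℂ y ≠ 0 → s • x + t • y = 0 → s = 0 ∧ t = 0 := by
    intro s t x y hxy h
    constructor
    · have := congrArg (fun z => ι ℂ z * ι ℂ y) h
      simp only [map_add, map_smul, add_mul, smul_mul_assoc, ι_sq_zero, smul_zero, add_zero,
        map_zero, zero_mul] at this
      exact (smul_eq_zero.1 this).resolve_right hxy
    · have := congrArg (fun z => ι ℂ x * ι ℂ z) h
      simp only [map_add, map_smul, mul_add, mul_smul_comm, ι_sq_zero, smul_zero, zero_add,
        map_zero, mul_zero] at this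
      exact (smul_eq_zero.1 this).resolve_right hxy
  refine ⟨g 0 • a + g 1 • b, fun h => ?_, aux _ _ _ _, ?_⟩
  · obtain ⟨h1, h2⟩ := aux' _ _ _ _ h0 h
    obtain ⟨h3, h4⟩ := aux' _ _ _ _ h0' (neg_eq_zero.1 (key.symm.trans h))
    fin_cases i <;> contradiction
  · rw [key, map_neg, neg_mul, aux, neg_zero]

/-- Contraction by a form dual to `v` writes `w = v ∧ u` with `v' ∧ u = 0`. Contraction by one dual
to `v'` then makes `u` a multiple of `v'`. -/
theorem exists_eq_smul_of_ι_mul_eq_zero {v v' : V} (h : LinearIndependent ℂ ![v, v'])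
    {w : ExteriorAlgebra ℂ V} (hw : w ∈ ⋀[ℂ]^2 V) (h₁ : ι ℂ v * w = 0) (h₂ : ι ℂ v' * w = 0) :
    ∃ c : ℂ, w = c • (ι ℂ v * ι ℂ v') := by
  obtain ⟨f, hf⟩ := exists_dual_family h
  have h00 : f 0 v = 1 := by simpa using hf 0 0
  have h01 : f 0 v' = 0 := by simpa using hf 0 1
  have h11 : f 1 v' = 1 := by simpa using hf 1 1
  obtain ⟨u, hu⟩ := mem_exteriorPower_one (contr_mem (f 0) hw)
  have h3 := congrArg (contr (f 0)) h₁
  rw [contr_ι_mul, h00, one_smul, hu, map_zero, sub_eq_zero] at h3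
  have h4 := congrArg (contr (f 0)) h₂
  rw [contr_ι_mul, h01, zero_smul, hu, map_zero, zero_sub, neg_eq_zero] at h4
  have h5 := congrArg (contr (f 1)) h4
  rw [contr_ι_mul, h11, one_smul, contr_ι, map_zero, sub_eq_zero, ← Algebra.commutes,
    ← Algebra.smul_def] at h5
  exact ⟨f 1 u, by rw [h3, h5, mul_smul_comm]⟩

end Exterior

/-! ### The spaces `F_v` and `L_v`, and the pairing between them. -/

section Fiber

variable {V : Type*} [AddCommGroup V] [Module ℂ V]

/-- The kernel of `v ∧ ·` on `⋀ⁿ V`. -/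
def wedgeKer (n : ℕ) (v : V) : Submodule ℂ (⋀[ℂ]^n V) :=
  LinearMap.ker (wedge 1 n (vec v))

theorem mem_wedgeKer {n : ℕ} {v : V} {x : ⋀[ℂ]^n V} :
    x ∈ wedgeKer n v ↔ ι ℂ v * (x : ExteriorAlgebra ℂ V) = 0 := by
  rw [wedgeKer, LinearMap.mem_ker, ← Subtype.coe_inj]
  rfl

theorem wedgeFiber_eq {v : V} (hv : v ≠ 0) : wedgeFiber v = wedgeKer 3 v := by
  ext x
  rw [mem_wedgeKer]
  constructor
  · rintro ⟨y, rfl⟩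
    exact ι_mul_ι_mul_self v _
  · intro h
    obtain ⟨y, hy, h⟩ := exists_eq_ι_mul hv x.2 h
    exact ⟨⟨y, hy⟩, Subtype.ext h.symm⟩

/-- The map `u ↦ v ∧ u`. -/
def wedgeVec (v : V) : V →ₗ[ℂ] ⋀[ℂ]^2 V := wedge 1 1 (vec v) ∘ₗ vec

@[simp]
theorem coe_wedgeVec (v u : V) : (wedgeVec v u : ExteriorAlgebra ℂ V) = ι ℂ v * ι ℂ u := rfl

theorem range_wedgeVec {v : V} (hv : v ≠ 0) : LinearMap.range (wedgeVec v) = wedgeKer 2 v := by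
  ext x
  rw [mem_wedgeKer]
  constructor
  · rintro ⟨y, rfl⟩
    exact ι_mul_ι_mul_self v _
  · intro h
    obtain ⟨u, h⟩ := exists_eq_ι_mul' hv x.2 h
    exact ⟨u, Subtype.ext h.symm⟩

theorem ker_wedgeVec {v : V} (hv : v ≠ 0) : LinearMap.ker (wedgeVec v) = Submodule.span ℂ {v} := by
  ext u
  rw [LinearMap.mem_ker, ← Subtype.coe_inj, Submodule.mem_span_singleton]
  simp only [coe_wedgeVec, ZeroMemClass.coe_zero]
  constructor
  · intro h
    obtain ⟨y, hy, h⟩ := exists_eq_ι_mul hv (ι_mem_exteriorPower_one u) h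
    obtain ⟨c, rfl⟩ := mem_exteriorPower_zero hy
    refine ⟨c, ?_⟩
    rw [← Algebra.commutes, ← Algebra.smul_def, ← map_smul, ι_inj] at h
    exact h.symm
  · rintro ⟨c, rfl⟩
    rw [map_smul, mul_smul_comm, ι_sq_zero, smul_zero]

theorem finrank_wedgeKer_two [FiniteDimensional ℂ V] {v : V} (hv : v ≠ 0) :
    finrank ℂ (wedgeKer 2 v) + 1 = finrank ℂ V := by
  rw [← range_wedgeVec hv, ← (wedgeVec v).finrank_range_add_finrank_ker, ker_wedgeVec hv,
    finrank_span_singleton hv]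

theorem finrank_wedgeKer_three [FiniteDimensional ℂ V] {v : V} (hv : v ≠ 0) :
    finrank ℂ (wedgeKer 3 v) + finrank ℂ (wedgeKer 2 v) = finrank ℂ (⋀[ℂ]^2 V) := by
  rw [← wedgeFiber_eq hv]
  exact (wedge 1 2 (vec v)).finrank_range_add_finrank_ker

theorem finrank_exteriorPower_two (hV : finrank ℂ V = 5) : finrank ℂ (⋀[ℂ]^2 V) = 10 := by
  have : FiniteDimensional ℂ V := FiniteDimensional.of_finrank_pos (by omega)
  rw [exteriorPower.finrank_eq, hV]
  rfl

variable (vol : ⋀[ℂ]^5 V ≃ₗ[ℂ] ℂ) (W : Submodule ℂ (⋀[ℂ]^2 V))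

/-- The linear form `vol (η ∧ ·)` on `⋀² V`. -/
def volDual : ⋀[ℂ]^3 V →ₗ[ℂ] Dual ℂ (⋀[ℂ]^2 V) :=
  (wedge 3 2).compr₂ vol.toLinearMap

theorem volDual_apply (η : ⋀[ℂ]^3 V) (w : ⋀[ℂ]^2 V) : volDual vol η w = vol (wedge 3 2 η w) := rfl

theorem volDual_eq_zero_iff {η : ⋀[ℂ]^3 V} {w : ⋀[ℂ]^2 V} :
    volDual vol η w = 0 ↔ (η : ExteriorAlgebra ℂ V) * w = 0 := by
  rw [volDual_apply, LinearEquiv.map_eq_zero_iff, ← Subtype.coe_inj]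
  rfl

theorem volDual_ne_zero (hV : finrank ℂ V = 5) {η : ⋀[ℂ]^3 V} (hη : η ≠ 0) :
    volDual vol η ≠ 0 := by
  have : FiniteDimensional ℂ V := FiniteDimensional.of_finrank_pos (by omega)
  intro h
  apply hη
  refine Subtype.ext (eq_zero_of_mul_eq_zero (k := 2) (by omega) η.2 fun y hy => ?_)
  rw [mul_comm_of_mem_two hy, ← volDual_eq_zero_iff vol (w := ⟨y, hy⟩), h, LinearMap.zero_apply]

/-- The vectors `w` of `W` with `v ∧ w = 0`. -/
def lineSpace (v : V) : Submodule ℂ W := (wedgeKer 2 v).comap W.subtype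

theorem mem_lineSpace {v : V} {w : W} :
    w ∈ lineSpace W v ↔ ι ℂ v * ((w : ⋀[ℂ]^2 V) : ExteriorAlgebra ℂ V) = 0 := by
  rw [lineSpace, Submodule.mem_comap, mem_wedgeKer, Submodule.subtype_apply]

theorem mul_eq_zero_of_mem_lineSpace {v : V} (hv : v ≠ 0) {w w' : W} (hw : w ∈ lineSpace W v)
    (hw' : w' ∈ lineSpace W v) :
    ((w : ⋀[ℂ]^2 V) : ExteriorAlgebra ℂ V) * (w' : ⋀[ℂ]^2 V) = 0 := by
  obtain ⟨u, hu⟩ := exists_eq_ι_mul' hv (w : ⋀[ℂ]^2 V).2 ((mem_lineSpace W).1 hw)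
  rw [hu, ι_mul_ι_swap, neg_mul, mul_assoc, (mem_lineSpace W).1 hw', mul_zero, neg_zero]

/-- The restriction to `W` of the linear forms `vol (η ∧ ·)` with `v ∧ η = 0`. -/
def fiberDual (v : V) : wedgeKer 3 v →ₗ[ℂ] Dual ℂ W :=
  W.subtype.dualMap ∘ₗ volDual vol ∘ₗ (wedgeKer 3 v).subtype

theorem fiberDual_apply (v : V) (η : wedgeKer 3 v) (w : W) :
    fiberDual vol W v η w = volDual vol (η : ⋀[ℂ]^3 V) (w : ⋀[ℂ]^2 V) := rfl

/-- Every `η` with `v ∧ η = 0` is `v ∧ y`, so pairing to zero with all of them means `y ∧ (v ∧ w) =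
0` for every `y`, hence `v ∧ w = 0`. -/
theorem dualCoannihilator_range_fiberDual (hV : finrank ℂ V = 5) {v : V} (hv : v ≠ 0) :
    (LinearMap.range (fiberDual vol W v)).dualCoannihilator = lineSpace W v := by
  have : FiniteDimensional ℂ V := FiniteDimensional.of_finrank_pos (by omega)
  ext w
  rw [Submodule.mem_dualCoannihilator, mem_lineSpace]
  constructor
  · intro h
    refine eq_zero_of_mul_eq_zero (n := 3) (k := 2) (by omega)
      (ι_mul_mem_exteriorPower v (w : ⋀[ℂ]^2 V).2) fun y hy => ?_
    have h1 := h _ ⟨⟨⟨ι ℂ v * y, ι_mul_mem_exteriorPower v hy⟩,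
      mem_wedgeKer.2 (ι_mul_ι_mul_self v y)⟩, rfl⟩
    rw [fiberDual_apply, volDual_eq_zero_iff] at h1
    rw [← mul_assoc, mul_comm_of_mem_two hy]
    exact h1
  · rintro h _ ⟨η, rfl⟩
    rw [fiberDual_apply, volDual_eq_zero_iff]
    obtain ⟨y, hy, hη⟩ := exists_eq_ι_mul hv (η : ⋀[ℂ]^3 V).2 (mem_wedgeKer.1 η.2)
    rw [hη, mul_assoc, mul_comm_of_mem_two hy, ← mul_assoc, h, zero_mul]

theorem range_fiberDual (hV : finrank ℂ V = 5) {v : V} (hv : v ≠ 0) :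
    LinearMap.range (fiberDual vol W v) = (lineSpace W v).dualAnnihilator := by
  have : FiniteDimensional ℂ V := FiniteDimensional.of_finrank_pos (by omega)
  rw [← dualCoannihilator_range_fiberDual vol W hV hv]
  exact (Subspace.dualCoannihilator_dualAnnihilator_eq (K := ℂ) (V := W)).symm

/-- The source has dimension `10 - 4 = 6` and the image, the annihilator of `L_v` in `W^∨`, has
dimension `7 - l`. -/
theorem finrank_ker_fiberDual (hV : finrank ℂ V = 5) (hW : finrank ℂ W = 7) {v : V} (hv : v ≠ 0) :
    finrank ℂ (LinearMap.ker (fiberDual vol W v)) + 1 = finrank ℂ (lineSpace W v) := by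
  have : FiniteDimensional ℂ V := FiniteDimensional.of_finrank_pos (by omega)
  have h1 := LinearMap.finrank_range_add_finrank_ker (K := ℂ) (V := wedgeKer 3 v) (V₂ := Dual ℂ W)
    (fiberDual vol W v)
  have h2 := Subspace.finrank_add_finrank_dualAnnihilator_eq (K := ℂ) (V := W) (lineSpace W v)
  rw [← range_fiberDual vol W hV hv] at h2
  have h3 := finrank_wedgeKer_two hv
  have h4 := finrank_wedgeKer_three hv
  rw [finrank_exteriorPower_two hV] at h4
  omega

end Fiber

/-! ### A large `L_v` produces a point of the hull with a large tangent space. -/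

section Hull

variable {V : Type*} [AddCommGroup V] [Module ℂ V] (W : Submodule ℂ (⋀[ℂ]^2 V))

theorem exists_quadratic_zero (a b c : ℂ) :
    ∃ s t : ℂ, (s ≠ 0 ∨ t ≠ 0) ∧ a * s ^ 2 + b * (s * t) + c * t ^ 2 = 0 := by
  by_cases ha : a = 0
  · exact ⟨1, 0, Or.inl one_ne_zero, by simp [ha]⟩
  obtain ⟨r, hr⟩ := IsAlgClosed.exists_eq_mul_self (discrim a b c)
  obtain ⟨x, hx⟩ := exists_quadratic_eq_zero ha ⟨r, hr⟩
  exact ⟨x, 1, Or.inr one_ne_zero, by linear_combination hx⟩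

theorem nonempty_vol (hV : finrank ℂ V = 5) : Nonempty (⋀[ℂ]^5 V ≃ₗ[ℂ] ℂ) := by
  have : FiniteDimensional ℂ V := FiniteDimensional.of_finrank_pos (by omega)
  refine ⟨LinearEquiv.ofFinrankEq _ _ ?_⟩
  rw [exteriorPower.finrank_eq, hV, finrank_self]
  rfl

theorem exists_pair_of_two_le_finrank {M : Type*} [AddCommMonoid M] [Module ℂ M]
    (h : 2 ≤ finrank ℂ M) :
    ∃ f : Fin 2 → M, ∀ s t : ℂ, s • f 0 + t • f 1 = 0 → s = 0 ∧ t = 0 := by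
  obtain ⟨f, hf⟩ := exists_linearIndependent_of_le_finrank h
  refine ⟨f, fun s t h0 => ?_⟩
  have h1 := Fintype.linearIndependent_iffₛ.1 hf ![s, t] 0 (by simpa [Fin.sum_univ_two] using h0)
  exact ⟨h1 0, h1 1⟩

/-- On a pencil of 3-vectors `v ∧ α`, decomposability follows from the vanishing of the binary
quadratic form `vol(v ∧ α ∧ α)`, which has a nontrivial zero over `ℂ`. -/
theorem exists_decomposable_mem_ker (hV : finrank ℂ V = 5) {v : V} (hv : v ≠ 0)
    {N : Submodule ℂ (wedgeKer 3 v)} (hN : 2 ≤ finrank ℂ N) :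
    ∃ η ∈ N, η ≠ 0 ∧ ∃ a b, ((η : ⋀[ℂ]^3 V) : ExteriorAlgebra ℂ V) = ι ℂ v * (ι ℂ a * ι ℂ b) := by
  have : FiniteDimensional ℂ V := FiniteDimensional.of_finrank_pos (by omega)
  obtain ⟨f, hf⟩ := exists_pair_of_two_le_finrank hN
  have hα : ∀ i, ∃ α : ⋀[ℂ]^2 V, (((f i : wedgeKer 3 v) : ⋀[ℂ]^3 V) : ExteriorAlgebra ℂ V) =
      ι ℂ v * (α : ExteriorAlgebra ℂ V) := by
    intro i
    obtain ⟨y, hy, h⟩ := exists_eq_ι_mul hv (f i : wedgeKer 3 v).1.2 (mem_wedgeKer.1 (f i).1.2)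
    exact ⟨⟨y, hy⟩, h⟩
  choose α hα using hα
  obtain ⟨vol⟩ := nonempty_vol hV
  let q : ⋀[ℂ]^2 V →ₗ[ℂ] ⋀[ℂ]^2 V →ₗ[ℂ] ℂ :=
    (wedge 2 2).compr₂ (vol.toLinearMap ∘ₗ wedge 1 4 (vec v))
  obtain ⟨s, t, hst, h⟩ := exists_quadratic_zero (q (α 0) (α 0)) (q (α 0) (α 1) + q (α 1) (α 0))
    (q (α 1) (α 1))
  set β := s • α 0 + t • α 1 with hβ
  have hq : q β β = 0 := by
    rw [hβ, ← h]
    simp only [map_add, map_smul, LinearMap.add_apply, LinearMap.smul_apply, smul_eq_mul]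
    ring
  have hq' : ι ℂ v * ((β : ExteriorAlgebra ℂ V) * β) = 0 := by
    have := (LinearEquiv.map_eq_zero_iff vol).1 hq
    exact congrArg Subtype.val this
  obtain ⟨a, b, hab⟩ := exists_ι_mul_eq hv β.2 hq'
  have hne : s • f 0 + t • f 1 ≠ 0 := by
    intro h0
    exact hst.elim (fun h => h (hf s t h0).1) (fun h => h (hf s t h0).2)
  have hcoe : (((s • f 0 + t • f 1 : N) : wedgeKer 3 v) : ⋀[ℂ]^3 V) =
      s • ((f 0 : wedgeKer 3 v) : ⋀[ℂ]^3 V) + t • ((f 1 : wedgeKer 3 v) : ⋀[ℂ]^3 V) := rfl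
  have heq : ((((s • f 0 + t • f 1 : N) : wedgeKer 3 v) : ⋀[ℂ]^3 V) : ExteriorAlgebra ℂ V) =
      ι ℂ v * (ι ℂ a * ι ℂ b) := by
    rw [← hab, hβ, hcoe]
    simp only [Submodule.coe_add, Submodule.coe_smul, hα, mul_add, mul_smul_comm]
  generalize s • f 0 + t • f 1 = η at hne heq
  exact ⟨η, η.2, fun h => hne (by rwa [ZeroMemClass.coe_eq_zero] at h), a, b, heq⟩

/-- The kernel is the tangent space at `p = u ∧ u'` to the cone over `G(2, V)`. The forms `x ↦ vol(x
∧ p ∧ w)` vanish on `⟨u, u'⟩`, so they span at most 3 of the 10 dimensions. -/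
theorem finrank_ker_mul (hV : finrank ℂ V = 5) {p : ⋀[ℂ]^2 V} (hp : p ≠ 0)
    (hpp : (p : ExteriorAlgebra ℂ V) * p = 0) :
    7 ≤ finrank ℂ (LinearMap.ker (wedge 2 2 p)) := by
  have : FiniteDimensional ℂ V := FiniteDimensional.of_finrank_pos (by omega)
  obtain ⟨vol⟩ := nonempty_vol hV
  obtain ⟨u, u', hu⟩ := exists_eq_ι_mul_ι p.2 hpp
  let τ : ⋀[ℂ]^2 V →ₗ[ℂ] Dual ℂ V :=
    ((wedge 1 4).compr₂ vol.toLinearMap).flip.compl₂ vec ∘ₗ wedge 2 2 p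
  have hτ : ∀ w x, τ w x = 0 ↔ ι ℂ x * ((p : ExteriorAlgebra ℂ V) * w) = 0 := by
    intro w x
    have : τ w x = vol (wedge 1 4 (vec x) (wedge 2 2 p w)) := rfl
    rw [this, LinearEquiv.map_eq_zero_iff, ← Subtype.coe_inj]
    rfl
  have hker : LinearMap.ker τ ≤ LinearMap.ker (wedge 2 2 p) := by
    intro w hw
    rw [LinearMap.mem_ker] at hw ⊢
    exact Subtype.ext (eq_zero_of_ι_mul (n := 4) (by omega) (wedge 2 2 p w).2
      fun x => (hτ w x).1 (by rw [hw, LinearMap.zero_apply]))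
  have huu : LinearIndependent ℂ ![u, u'] := by
    rw [LinearIndependent.pair_iff]
    intro s t hst
    have hp' : ι ℂ u * ι ℂ u' ≠ 0 := fun h => hp (Subtype.ext (hu.trans h))
    constructor
    · have := congrArg (fun z => ι ℂ z * ι ℂ u') hst
      simp only [map_add, map_smul, add_mul, smul_mul_assoc, ι_sq_zero, smul_zero, add_zero,
        map_zero, zero_mul] at this
      exact (smul_eq_zero.1 this).resolve_right hp'
    · have := congrArg (fun z => ι ℂ u * ι ℂ z) hst
      simp only [map_add, map_smul, mul_add, mul_smul_comm, ι_sq_zero, smul_zero, zero_add,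
        map_zero, mul_zero] at this
      exact (smul_eq_zero.1 this).resolve_right hp'
  have hrange : LinearMap.range τ ≤ (Submodule.span ℂ (Set.range ![u, u'])).dualAnnihilator := by
    rintro _ ⟨w, rfl⟩
    rw [Submodule.mem_dualAnnihilator]
    intro x hx
    rw [Matrix.range_cons_cons_empty, Submodule.mem_span_pair] at hx
    obtain ⟨s, t, rfl⟩ := hx
    rw [hτ, hu, mul_assoc, map_add, map_smul, map_smul, add_mul, smul_mul_assoc, smul_mul_assoc,
      ι_mul_ι_mul_self, ι_mul_ι_mul_swap, ι_mul_ι_mul_self, mul_zero, neg_zero, smul_zero,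
      smul_zero, add_zero]
  have h1 := LinearMap.finrank_range_add_finrank_ker (K := ℂ) (V := ⋀[ℂ]^2 V) (V₂ := Dual ℂ V) τ
  have h2 := Subspace.finrank_add_finrank_dualAnnihilator_eq (K := ℂ) (V := V)
    (Submodule.span ℂ (Set.range ![u, u']))
  rw [finrank_span_eq_card huu, Fintype.card_fin, hV] at h2
  have h3 := Submodule.finrank_mono hrange
  have h4 := Submodule.finrank_mono hker
  rw [finrank_exteriorPower_two hV] at h1
  omega

theorem exists_mem_large_tangent (hV : finrank ℂ V = 5) (hW : finrank ℂ W = 7) {v : V}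
    (hv : v ≠ 0) (h : 3 ≤ finrank ℂ (lineSpace W v)) :
    ∃ p : W, p ≠ 0 ∧ ((p : ⋀[ℂ]^2 V) : ExteriorAlgebra ℂ V) * (p : ⋀[ℂ]^2 V) = 0 ∧
      5 ≤ finrank ℂ ((LinearMap.ker (wedge 2 2 (p : ⋀[ℂ]^2 V))).comap W.subtype) := by
  have : FiniteDimensional ℂ V := FiniteDimensional.of_finrank_pos (by omega)
  obtain ⟨vol⟩ := nonempty_vol hV
  have h1 := finrank_ker_fiberDual vol W hV hW hv
  obtain ⟨η, hηN, hη0, a, b, hη⟩ := exists_decomposable_mem_ker hV hv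
    (N := LinearMap.ker (fiberDual vol W v)) (by omega)
  have hηW : W ≤ LinearMap.ker (volDual vol (η : ⋀[ℂ]^3 V)) := by
    intro w hw
    have := LinearMap.congr_fun (LinearMap.mem_ker.1 hηN) ⟨w, hw⟩
    exact this
  have hη0' : (η : ⋀[ℂ]^3 V) ≠ 0 := fun h => hη0 (Subtype.ext h)
  have hη0'' : ((η : ⋀[ℂ]^3 V) : ExteriorAlgebra ℂ V) ≠ 0 := fun h => hη0' (Subtype.ext h)
  have hH : finrank ℂ (LinearMap.ker (volDual vol (η : ⋀[ℂ]^3 V))) + 1 = 10 := by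
    rw [← finrank_exteriorPower_two hV]
    exact Dual.finrank_ker_add_one_of_ne_zero (K := ℂ) (V₁ := ⋀[ℂ]^2 V) (volDual_ne_zero vol hV hη0')
  generalize hξ : (η : ⋀[ℂ]^3 V) = ξ at *
  -- `g` parametrizes `⋀²⟨v, a, b⟩`. Wedging with `v`, `a`, `b` recovers each coordinate, up to
  -- sign, as a multiple of `ξ = v ∧ a ∧ b`.
  let g : (Fin 3 → ℂ) →ₗ[ℂ] ⋀[ℂ]^2 V :=
    Fintype.linearCombination ℂ ![wedgeVec v a, wedgeVec v b, wedgeVec a b]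
  have hg : ∀ c, (g c : ExteriorAlgebra ℂ V) =
      c 0 • (ι ℂ v * ι ℂ a) + c 1 • (ι ℂ v * ι ℂ b) + c 2 • (ι ℂ a * ι ℂ b) := by
    intro c
    simp [g, Fintype.linearCombination_apply, Fin.sum_univ_three]
  have hgv : ∀ c, ι ℂ v * (g c : ExteriorAlgebra ℂ V) = c 2 • (ξ : ExteriorAlgebra ℂ V) := by
    intro c
    simp only [hg, hη, mul_add, mul_smul_comm, ι_mul_ι_mul_self, smul_zero, zero_add]
  have hga : ∀ c, ι ℂ a * (g c : ExteriorAlgebra ℂ V) = - c 1 • (ξ : ExteriorAlgebra ℂ V) := by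
    intro c
    simp only [hg, hη, mul_add, mul_smul_comm, ι_mul_ι_mul_self, smul_zero, add_zero,
      ι_mul_ι_mul_swap a v, ι_sq_zero, mul_zero, neg_zero, zero_add, smul_neg, neg_smul]
  have hgb : ∀ c, ι ℂ b * (g c : ExteriorAlgebra ℂ V) = c 0 • (ξ : ExteriorAlgebra ℂ V) := by
    intro c
    simp only [hg, hη, mul_add, mul_smul_comm, ι_mul_ι_mul_swap b v, ι_mul_ι_mul_swap b a,
      ι_sq_zero, mul_zero, neg_zero, smul_zero, add_zero, ι_mul_ι_swap b a, mul_neg, neg_neg]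
  have hginj : Function.Injective g := by
    rw [← LinearMap.ker_eq_bot, LinearMap.ker_eq_bot']
    intro c hc
    have hc' : (g c : ExteriorAlgebra ℂ V) = 0 := congrArg Subtype.val hc
    have h0 := hgb c
    have h1 := hga c
    have h2 := hgv c
    rw [hc', mul_zero, eq_comm, smul_eq_zero, or_iff_left hη0''] at h0 h1 h2
    ext i
    fin_cases i
    exacts [h0, neg_eq_zero.1 h1, h2]
  -- A nonzero `g c` has a nonzero coordinate, hence divides `ξ`: its tangent space lies in `ξ^⊥`.
  have hkill : ∀ c, g c ≠ 0 → LinearMap.ker (wedge 2 2 (g c)) ≤ LinearMap.ker (volDual vol ξ) := by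
    intro c hc w hw
    have hw' : (g c : ExteriorAlgebra ℂ V) * w = 0 := congrArg Subtype.val (LinearMap.mem_ker.1 hw)
    rw [LinearMap.mem_ker, volDual_eq_zero_iff]
    have key : ∀ (x : V) (r : ℂ), ι ℂ x * (g c : ExteriorAlgebra ℂ V) =
        r • (ξ : ExteriorAlgebra ℂ V) → r ≠ 0 → (ξ : ExteriorAlgebra ℂ V) * w = 0 := by
      intro x r hx hr
      have := congrArg (· * (w : ExteriorAlgebra ℂ V)) hx
      simp only [mul_assoc, hw', mul_zero, smul_mul_assoc] at this
      exact (smul_eq_zero.1 this.symm).resolve_left hr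
    by_contra hcon
    apply hc
    have h0 := not_imp_comm.1 (key _ _ (hgb c)) hcon
    have h1 := not_imp_comm.1 (key _ _ (hga c)) hcon
    have h2 := not_imp_comm.1 (key _ _ (hgv c)) hcon
    apply Subtype.ext
    rw [hg, h0, neg_eq_zero.1 h1, h2]
    simp
  have hsq : ∀ c, (g c : ExteriorAlgebra ℂ V) * g c = 0 := by
    intro c
    nth_rewrite 1 [hg]
    simp only [add_mul, smul_mul_assoc, mul_assoc, hga, hgb, mul_smul_comm, hη, ι_mul_ι_mul_self,
      smul_zero, ι_mul_ι_mul_swap a v, neg_zero, mul_zero, add_zero]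
  have hgrange : LinearMap.range g ≤ LinearMap.ker (volDual vol ξ) := by
    rintro _ ⟨c, rfl⟩
    by_cases hc : g c = 0
    · rw [hc]; exact zero_mem _
    · exact hkill c hc (LinearMap.mem_ker.2 (Subtype.ext (hsq c)))
  have hdim := LinearMap.finrank_range_of_inj hginj
  rw [finrank_fin_fun] at hdim
  have hinf := Submodule.finrank_sup_add_finrank_inf_eq (K := ℂ) (V := ⋀[ℂ]^2 V)
    (LinearMap.range g) W
  have hsup := Submodule.finrank_mono (sup_le hgrange hηW)
  -- The intersection is nonzero since `3 + 7 > 9`.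
  obtain ⟨p, hp, hp0⟩ := Submodule.exists_mem_ne_zero_of_ne_bot
    (p := LinearMap.range g ⊓ W) (by
      intro h
      rw [h, finrank_bot] at hinf
      omega)
  obtain ⟨⟨c, rfl⟩, hpW⟩ := hp
  refine ⟨⟨g c, hpW⟩, fun h => hp0 (congrArg Subtype.val h), hsq c, ?_⟩
  have hT := finrank_ker_mul hV hp0 (hsq c)
  -- Inside the 9-dimensional `ξ^⊥`, the intersection has dimension at least `7 + 7 - 9 = 5`.
  have hinf' := Submodule.finrank_sup_add_finrank_inf_eq (K := ℂ) (V := ⋀[ℂ]^2 V)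
    (LinearMap.ker (wedge 2 2 (g c))) W
  have hsup' := Submodule.finrank_mono (sup_le (hkill c hp0) hηW)
  have hcomap : finrank ℂ ((LinearMap.ker (wedge 2 2 (g c))).comap W.subtype) =
      finrank ℂ (LinearMap.ker (wedge 2 2 (g c)) ⊓ W : Submodule ℂ (⋀[ℂ]^2 V)) := by
    rw [inf_comm, ← Submodule.map_comap_subtype]
    exact (Submodule.finrank_map_subtype_eq _ _).symm
  dsimp only
  omega

end Hull

/-! ### Consequences of smoothness; lines in `S` as spaces `L_v`. -/

section Smooth

variable {V : Type*} [AddCommGroup V] [Module ℂ V] (vol : ⋀[ℂ]^5 V ≃ₗ[ℂ] ℂ)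
  (W : Submodule ℂ (⋀[ℂ]^2 V))

theorem forall_pfaffian_eq_zero_iff (hV : finrank ℂ V = 5) {w w' : W} :
    (∀ v, pfaffian vol W v w w' = 0) ↔
      ((w : ⋀[ℂ]^2 V) : ExteriorAlgebra ℂ V) * (w' : ⋀[ℂ]^2 V) = 0 := by
  have : FiniteDimensional ℂ V := FiniteDimensional.of_finrank_pos (by omega)
  have h : ∀ v, pfaffian vol W v w w' = 0 ↔
      ι ℂ v * (((w : ⋀[ℂ]^2 V) : ExteriorAlgebra ℂ V) * (w' : ⋀[ℂ]^2 V)) = 0 := by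
    intro v
    have : pfaffian vol W v w w' =
      vol (wedge 1 4 (vec v) (wedge 2 2 (w : ⋀[ℂ]^2 V) (w' : ⋀[ℂ]^2 V))) := rfl
    rw [this, LinearEquiv.map_eq_zero_iff, ← Subtype.coe_inj]
    rfl
  simp only [h]
  constructor
  · exact eq_zero_of_ι_mul (n := 4) (by omega) (wedge 2 2 (w : ⋀[ℂ]^2 V) (w' : ⋀[ℂ]^2 V)).2
  · intro h v
    rw [h, mul_zero]

theorem coneTangent_pfaffian (hV : finrank ℂ V = 5) (p : W) :
    coneTangent (pfaffian vol W) p =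
      (LinearMap.ker (wedge 2 2 (p : ⋀[ℂ]^2 V))).comap W.subtype := by
  ext w
  simp only [coneTangent, Submodule.mem_iInf, LinearMap.mem_ker, Submodule.mem_comap]
  rw [forall_pfaffian_eq_zero_iff vol W hV, ← Subtype.coe_inj]
  rfl

theorem finrank_lineSpace_le (hV : finrank ℂ V = 5) {γ : LinearMap.BilinForm ℂ W}
    (hS : IsStronglySmooth vol W γ 2) {v : V} (hv : v ≠ 0) : finrank ℂ (lineSpace W v) ≤ 2 := by
  by_contra! h
  obtain ⟨p, hp0, hpp, hp⟩ := exists_mem_large_tangent W hV hS.finrank_eq hv h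
  have hcone : p ∈ quadricCone (pfaffian vol W) := (forall_pfaffian_eq_zero_iff vol W hV).2 hpp
  have h1 := hS.hull_smooth ⟨p, hcone⟩ hp0
  rw [hS.hull_dim ⟨p, hcone⟩ hp0, coneTangent_pfaffian vol W hV] at h1
  -- The hull has dimension `2 + 1`, and its affine cone adds one.
  have h2 : finrank ℂ ((LinearMap.ker (wedge 2 2 (p : ⋀[ℂ]^2 V))).comap W.subtype) = 2 + 1 + 1 := by
    exact_mod_cast h1
  omega

/-- Polarization. The parameters `(v, 0)` and `(0, 1)` separate the Pfaffians from `γ`. -/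
theorem mem_linesIn_iff (hV : finrank ℂ V = 5) {γ : LinearMap.BilinForm ℂ W} (hγ : γ.IsSymm)
    {L : Submodule ℂ W} : L ∈ linesIn (gmQuadrics vol W γ) ↔ finrank ℂ L = 2 ∧
      ∀ w ∈ L, ∀ w' ∈ L, ((w : ⋀[ℂ]^2 V) : ExteriorAlgebra ℂ V) * (w' : ⋀[ℂ]^2 V) = 0 ∧
        γ w w' = 0 := by
  refine and_congr_right fun _ => ⟨fun h => ?_, fun h w hw x => ?_⟩
  · have hsq : ∀ w ∈ L, ((w : ⋀[ℂ]^2 V) : ExteriorAlgebra ℂ V) * (w : ⋀[ℂ]^2 V) = 0 ∧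
        γ w w = 0 := by
      refine fun w hw => ⟨(forall_pfaffian_eq_zero_iff vol W hV).1 fun v => ?_, ?_⟩
      · simpa [gmQuadrics] using h w hw (v, 0)
      · have h0 : pfaffian vol W 0 w w = 0 := by simp [pfaffian]
        simpa [gmQuadrics, h0] using h w hw (0, 1)
    intro w hw w' hw'
    obtain ⟨h1, h2⟩ := hsq _ (add_mem hw hw')
    constructor
    · simp only [Submodule.coe_add, add_mul, mul_add, (hsq w hw).1, (hsq w' hw').1, zero_add,
        add_zero, mul_comm_of_mem_two (w' : ⋀[ℂ]^2 V).2, ← two_smul ℂ] at h1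
      exact (smul_eq_zero.1 h1).resolve_left two_ne_zero
    · have h3 : γ w' w = γ w w' := (hγ.eq w w').symm
      simp only [map_add, LinearMap.add_apply, (hsq w hw).2, (hsq w' hw').2, zero_add,
        add_zero, h3, ← two_mul] at h2
      exact (mul_eq_zero.1 h2).resolve_left two_ne_zero
  · obtain ⟨h1, h2⟩ := h w hw w hw
    have h3 := (forall_pfaffian_eq_zero_iff vol W hV).2 h1 x.1
    simp [gmQuadrics, h2, h3]

theorem exists_pair_of_finrank_eq_two {M : Type*} [AddCommMonoid M] [Module ℂ M]
    [Module.Finite ℂ M] {L : Submodule ℂ M} (hL : finrank ℂ L = 2) :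
    ∃ x ∈ L, ∃ y ∈ L, x ≠ 0 ∧ y ≠ 0 ∧
      ∀ K : Submodule ℂ M, x ∈ K → y ∈ K → finrank ℂ K ≤ 2 → K = L := by
  let _ : AddCommGroup M := Module.addCommMonoidToAddCommGroup ℂ
  let b := finBasisOfFinrankEq ℂ L hL
  have hb : ∀ i, (b i : M) ≠ 0 := fun i h => b.ne_zero i (Subtype.ext h)
  refine ⟨b 0, (b 0).2, b 1, (b 1).2, hb 0, hb 1, fun K hx hy hK => ?_⟩
  have hle : ⊤ ≤ K.comap L.subtype := by
    rw [← b.span_eq, Submodule.span_le]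
    rintro _ ⟨i, rfl⟩
    fin_cases i
    exacts [hx, hy]
  exact (Submodule.eq_of_le_of_finrank_le (fun w hw => hle (x := ⟨w, hw⟩) trivial)
    (by rwa [hL])).symm

/-- A common factor `v` of two spanning vectors gives `L ⊆ L_v`, and the bound `l ≤ 2` makes this an
equality. -/
theorem exists_lineSpace_eq (hV : finrank ℂ V = 5) {γ : LinearMap.BilinForm ℂ W} (hγ : γ.IsSymm)
    (hS : IsStronglySmooth vol W γ 2) {L : Submodule ℂ W}
    (hL : L ∈ linesIn (gmQuadrics vol W γ)) : ∃ v, v ≠ 0 ∧ lineSpace W v = L := by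
  have : FiniteDimensional ℂ V := FiniteDimensional.of_finrank_pos (by omega)
  obtain ⟨hL2, hL⟩ := (mem_linesIn_iff vol W hV hγ).1 hL
  obtain ⟨x, hx, y, hy, hx0, hy0, h⟩ := exists_pair_of_finrank_eq_two hL2
  have hcoe : ∀ w : W, w ≠ 0 → ((w : ⋀[ℂ]^2 V) : ExteriorAlgebra ℂ V) ≠ 0 := by
    intro w hw h
    exact hw (Subtype.ext (Subtype.ext h))
  obtain ⟨v, hv, h0, h1⟩ := exists_common_factor (x : ⋀[ℂ]^2 V).2 (y : ⋀[ℂ]^2 V).2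
    (hL _ hx _ hx).1 (hL _ hy _ hy).1 (hL _ hx _ hy).1 (hcoe x hx0) (hcoe y hy0)
  exact ⟨v, hv, h _ ((mem_lineSpace W).2 h0) ((mem_lineSpace W).2 h1)
    (finrank_lineSpace_le vol W hV hS hv)⟩

theorem finrank_lineSpace_inf_le {v v' : V} (h : LinearIndependent ℂ ![v, v']) :
    finrank ℂ (lineSpace W v ⊓ lineSpace W v' : Submodule ℂ W) ≤ 1 := by
  have hle : (lineSpace W v ⊓ lineSpace W v').map W.subtype ≤
      Submodule.span ℂ {wedgeVec v v'} := by
    rintro _ ⟨w, ⟨hw, hw'⟩, rfl⟩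
    obtain ⟨c, hc⟩ := exists_eq_smul_of_ι_mul_eq_zero h (w : ⋀[ℂ]^2 V).2 ((mem_lineSpace W).1 hw)
      ((mem_lineSpace W).1 hw')
    exact Submodule.mem_span_singleton.2 ⟨c, Subtype.ext hc.symm⟩
  rw [← Submodule.finrank_map_subtype_eq]
  exact (Submodule.finrank_mono hle).trans ((finrank_span_le_card _).trans (by simp))

end Smooth

/-! ### The dimension of `F_v ∩ A(S)` for `v ∈ V`. -/

section Fiber

theorem finrank_eq_map_snd_add_comap_inl {A B : Type*} [AddCommMonoid A] [Module ℂ A]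
    [AddCommMonoid B] [Module ℂ B] [Module.Finite ℂ A] [Module.Finite ℂ B]
    (P : Submodule ℂ (A × B)) :
    finrank ℂ P = finrank ℂ (P.map (LinearMap.snd ℂ A B)) +
      finrank ℂ (P.comap (LinearMap.inl ℂ A B)) := by
  let _ : AddCommGroup A := Module.addCommMonoidToAddCommGroup ℂ
  let _ : AddCommGroup B := Module.addCommMonoidToAddCommGroup ℂ
  rw [← (LinearMap.snd ℂ A B ∘ₗ P.subtype).finrank_range_add_finrank_ker, LinearMap.range_comp,
    Submodule.range_subtype]
  congr 1
  let e : P.comap (LinearMap.inl ℂ A B) →ₗ[ℂ] P :=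
    (LinearMap.inl ℂ A B).restrict fun _ h => h
  have he : Function.Injective e := fun x y h => Subtype.ext (congrArg (fun z => z.1.1) h)
  rw [← LinearMap.finrank_range_of_inj he]
  have hker : LinearMap.ker (LinearMap.snd ℂ A B ∘ₗ P.subtype) = LinearMap.range e := ?_
  · rw [hker]
  ext ⟨⟨a, b⟩, hP⟩
  constructor
  · intro hb
    obtain rfl : b = 0 := hb
    exact ⟨⟨a, hP⟩, rfl⟩
  · rintro ⟨x, hx⟩
    exact (congrArg (fun z => z.1.2) hx).symm

theorem le_of_le_of_finrank_le {M : Type*} [AddCommMonoid M] [Module ℂ M] [Module.Finite ℂ M]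
    {K L : Submodule ℂ M} (h : K ≤ L) (h' : finrank ℂ L ≤ finrank ℂ K) : L ≤ K := by
  let _ : AddCommGroup M := Module.addCommMonoidToAddCommGroup ℂ
  exact (Submodule.eq_of_le_of_finrank_le h h').ge

variable {V : Type*} [AddCommGroup V] [Module ℂ V] (vol : ⋀[ℂ]^5 V ≃ₗ[ℂ] ℂ)
  (W : Submodule ℂ (⋀[ℂ]^2 V))

theorem coe_exteriorPower_map {V' : Type*} [AddCommGroup V'] [Module ℂ V'] (f : V →ₗ[ℂ] V')
    (n : ℕ) (x : ⋀[ℂ]^n V) :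
    (exteriorPower.map n f x : ExteriorAlgebra ℂ V') = ExteriorAlgebra.map f x := by
  have h : (⋀[ℂ]^n V').subtype ∘ₗ exteriorPower.map n f =
      (ExteriorAlgebra.map f).toLinearMap ∘ₗ (⋀[ℂ]^n V).subtype := by
    refine exteriorPower.linearMap_ext (AlternatingMap.ext fun m => ?_)
    simp only [LinearMap.compAlternatingMap_apply, LinearMap.comp_apply,
      exteriorPower.map_apply_ιMulti, Submodule.subtype_apply, exteriorPower.ιMulti_apply_coe,
      AlgHom.toLinearMap_apply, map_apply_ιMulti]
  exact LinearMap.congr_fun h x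

theorem map_fst_map_inl (x : ExteriorAlgebra ℂ V) :
    ExteriorAlgebra.map (LinearMap.fst ℂ V ℂ) (ExteriorAlgebra.map (LinearMap.inl ℂ V ℂ) x) = x := by
  have h := ExteriorAlgebra.map_comp_map (LinearMap.inl ℂ V ℂ) (LinearMap.fst ℂ V ℂ)
  rw [LinearMap.fst_comp_inl, ExteriorAlgebra.map_id] at h
  exact DFunLike.congr_fun h x

/-- Projection along `x = (0, 1)` isolates the first summand. If `x ∧ y = 0`, then `y` is divisible
by `x`, and the same projection kills it. -/
theorem map_inl_add_eq_zero {n : ℕ} {x y : ExteriorAlgebra ℂ V} (hy : y ∈ ⋀[ℂ]^(n + 1) V)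
    (h : ExteriorAlgebra.map (LinearMap.inl ℂ V ℂ) x +
      ι ℂ ((0, 1) : V × ℂ) * ExteriorAlgebra.map (LinearMap.inl ℂ V ℂ) y = 0) : x = 0 ∧ y = 0 := by
  have hfst : ExteriorAlgebra.map (LinearMap.fst ℂ V ℂ) (ι ℂ ((0, 1) : V × ℂ)) = 0 := by
    rw [ExteriorAlgebra.map_apply_ι, LinearMap.fst_apply, map_zero]
  have hx : x = 0 := by
    have := congrArg (ExteriorAlgebra.map (LinearMap.fst ℂ V ℂ)) h
    rwa [map_add, map_mul, hfst, zero_mul, add_zero, map_fst_map_inl, map_zero] at this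
  refine ⟨hx, ?_⟩
  rw [hx, map_zero, zero_add] at h
  obtain ⟨z, -, hz⟩ := exists_eq_ι_mul (by simp)
    (by rw [← coe_exteriorPower_map _ _ ⟨y, hy⟩]; exact SetLike.coe_mem _) h
  have := congrArg (ExteriorAlgebra.map (LinearMap.fst ℂ V ℂ)) hz
  rwa [map_mul, hfst, zero_mul, map_fst_map_inl] at this

theorem coe_glue (η : ⋀[ℂ]^3 V) (w : ⋀[ℂ]^2 V) :
    (glue (η, w) : ExteriorAlgebra ℂ (V × ℂ)) = ExteriorAlgebra.map (LinearMap.inl ℂ V ℂ) η +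
      ι ℂ ((0, 1) : V × ℂ) * ExteriorAlgebra.map (LinearMap.inl ℂ V ℂ) w := by
  rw [← coe_exteriorPower_map, ← coe_exteriorPower_map]
  rfl

theorem glue_injective : Function.Injective (glue (V := V)) := by
  rw [← LinearMap.ker_eq_bot, LinearMap.ker_eq_bot']
  rintro ⟨η, w⟩ h
  have h1 := congrArg Subtype.val h
  rw [coe_glue] at h1
  obtain ⟨h2, h3⟩ := map_inl_add_eq_zero w.2 h1
  exact Prod.ext (Subtype.ext h2) (Subtype.ext h3)

/-- `v ∧ (η + x ∧ w) = v ∧ η - x ∧ (v ∧ w)`, and the two components are independent. -/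
theorem glue_mem_wedgeKer {v : V} {η : ⋀[ℂ]^3 V} {w : ⋀[ℂ]^2 V} :
    glue (η, w) ∈ wedgeKer 3 ((v, 0) : V × ℂ) ↔ η ∈ wedgeKer 3 v ∧ w ∈ wedgeKer 2 v := by
  have h : ι ℂ ((v, 0) : V × ℂ) * (glue (η, w) : ExteriorAlgebra ℂ (V × ℂ)) =
      ExteriorAlgebra.map (LinearMap.inl ℂ V ℂ) (ι ℂ v * η) +
      ι ℂ ((0, 1) : V × ℂ) * ExteriorAlgebra.map (LinearMap.inl ℂ V ℂ) (- (ι ℂ v * w)) := by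
    rw [coe_glue, mul_add, ι_mul_ι_mul_swap, map_neg, map_mul, map_mul, ExteriorAlgebra.map_apply_ι, mul_neg]
    rfl
  rw [mem_wedgeKer, mem_wedgeKer, mem_wedgeKer, h]
  constructor
  · intro h0
    obtain ⟨h1, h2⟩ := map_inl_add_eq_zero (neg_mem (ι_mul_mem_exteriorPower v w.2)) h0
    exact ⟨h1, neg_eq_zero.1 h2⟩
  · rintro ⟨h1, h2⟩
    rw [h1, h2, neg_zero, map_zero, mul_zero, add_zero]

/-- The pairs `(η, w)` of `lagrangianPairs` with `v ∧ η = 0` and `v ∧ w = 0`. -/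
def fiberPairs (γ : LinearMap.BilinForm ℂ W) (v : V) : Submodule ℂ (⋀[ℂ]^3 V × W) :=
  (wedgeKer 3 v).prod (lineSpace W v) ⊓ lagrangianPairs vol W γ

theorem mem_fiberPairs {γ : LinearMap.BilinForm ℂ W} {v : V} {η : ⋀[ℂ]^3 V} {w : W} :
    (η, w) ∈ fiberPairs vol W γ v ↔ (η ∈ wedgeKer 3 v ∧ w ∈ lineSpace W v) ∧
      ∀ w' : W, volDual vol η w' = - γ w w' := Iff.rfl

theorem finrank_wedgeFiber_inf_lagrangian (γ : LinearMap.BilinForm ℂ W) {v : V} (hv : v ≠ 0) :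
    finrank ℂ (wedgeFiber ((v, 0) : V × ℂ) ⊓ lagrangian vol W γ :
      Submodule ℂ (⋀[ℂ]^3 (V × ℂ))) = finrank ℂ (fiberPairs vol W γ v) := by
  let G : (⋀[ℂ]^3 V × W) →ₗ[ℂ] ⋀[ℂ]^3 (V × ℂ) :=
    glue ∘ₗ LinearMap.prodMap LinearMap.id W.subtype
  have hG : ∀ η w, G (η, w) = glue (η, (w : ⋀[ℂ]^2 V)) := fun _ _ => rfl
  have hinj : Function.Injective G := by
    rintro ⟨η, w⟩ ⟨η', w'⟩ h
    rw [hG, hG] at h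
    obtain ⟨h1, h2⟩ := Prod.ext_iff.1 (glue_injective h)
    exact Prod.ext h1 (Subtype.ext h2)
  have hmem : ∀ {η : ⋀[ℂ]^3 V} {w : W}, G (η, w) ∈ wedgeFiber ((v, 0) : V × ℂ) ↔
      (η, w) ∈ (wedgeKer 3 v).prod (lineSpace W v) := by
    intro η w
    rw [wedgeFiber_eq (by simpa using hv), hG, glue_mem_wedgeKer, Submodule.mem_prod, lineSpace,
      Submodule.mem_comap, Submodule.subtype_apply]
  have hmap : wedgeFiber ((v, 0) : V × ℂ) ⊓ (lagrangianPairs vol W γ).map G =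
      (fiberPairs vol W γ v).map G := by
    ext x
    rw [Submodule.mem_inf, Submodule.mem_map, Submodule.mem_map]
    constructor
    · rintro ⟨h1, ⟨η, w⟩, h2, rfl⟩
      exact ⟨(η, w), Submodule.mem_inf.2 ⟨hmem.1 h1, h2⟩, rfl⟩
    · rintro ⟨⟨η, w⟩, h, rfl⟩
      exact ⟨hmem.2 (Submodule.mem_inf.1 h).1, ⟨(η, w), (Submodule.mem_inf.1 h).2, rfl⟩⟩
  rw [show lagrangian vol W γ = (lagrangianPairs vol W γ).map G from rfl, hmap]
  exact (Submodule.equivMapOfInjective G hinj _).finrank_eq.symm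

theorem volDual_eq_zero_of_mem {v : V} (hv : v ≠ 0) {η : ⋀[ℂ]^3 V} (hη : η ∈ wedgeKer 3 v)
    {w : W} (hw : w ∈ lineSpace W v) : volDual vol η w = 0 := by
  obtain ⟨y, hy, h⟩ := exists_eq_ι_mul hv η.2 (mem_wedgeKer.1 hη)
  rw [volDual_eq_zero_iff, h, mul_assoc, mul_comm_of_mem_two hy, ← mul_assoc,
    (mem_lineSpace W).1 hw, zero_mul]

theorem finrank_comap_inl_fiberPairs (γ : LinearMap.BilinForm ℂ W) (v : V) :
    finrank ℂ ((fiberPairs vol W γ v).comap (LinearMap.inl ℂ _ _)) =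
      finrank ℂ (LinearMap.ker (fiberDual vol W v)) := by
  have h : (fiberPairs vol W γ v).comap (LinearMap.inl ℂ _ _) =
      (LinearMap.ker (fiberDual vol W v)).map (wedgeKer 3 v).subtype := by
    ext η
    rw [Submodule.mem_comap, LinearMap.inl_apply, mem_fiberPairs]
    simp only [map_zero, LinearMap.zero_apply, neg_zero]
    constructor
    · rintro ⟨⟨h1, -⟩, h2⟩
      exact ⟨⟨η, h1⟩, LinearMap.mem_ker.2 (LinearMap.ext h2), rfl⟩
    · rintro ⟨η, h1, rfl⟩
      exact ⟨⟨η.2, zero_mem _⟩, LinearMap.congr_fun (LinearMap.mem_ker.1 h1)⟩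
  rw [h]
  exact Submodule.finrank_map_subtype_eq _ _

/-- The image is the radical of `γ` on `L_v`: an `η` with `vol(η ∧ ·) = -γ(w, ·)` on `W` and `v ∧ η
= 0` exists iff `γ(w, ·)` annihilates `L_v`. -/
theorem mem_map_snd_fiberPairs (hV : finrank ℂ V = 5) (γ : LinearMap.BilinForm ℂ W) {v : V}
    (hv : v ≠ 0) {w : W} : w ∈ (fiberPairs vol W γ v).map (LinearMap.snd ℂ _ _) ↔
      w ∈ lineSpace W v ∧ ∀ w' ∈ lineSpace W v, γ w w' = 0 := by
  constructor
  · rintro ⟨⟨η, w⟩, h, rfl⟩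
    obtain ⟨⟨h1, h2⟩, h3⟩ := (mem_fiberPairs vol W).1 h
    refine ⟨h2, fun w' hw' => ?_⟩
    rw [← neg_eq_zero, ← volDual_eq_zero_of_mem vol W hv h1 hw']
    exact (h3 w').symm
  · rintro ⟨h1, h2⟩
    have h3 : - γ w ∈ LinearMap.range (fiberDual vol W v) := by
      rw [range_fiberDual vol W hV hv, Submodule.mem_dualAnnihilator]
      intro w' hw'
      rw [LinearMap.neg_apply, h2 w' hw', neg_zero]
    obtain ⟨η, hη⟩ := h3
    exact ⟨(η, w), (mem_fiberPairs vol W).2 ⟨⟨η.2, h1⟩, fun w' => LinearMap.congr_fun hη w'⟩, rfl⟩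

/-- The dimension is `r + (l - 1)` with `r ≤ l ≤ 2`, so it reaches 3 only when `r = l = 2`, where
`γ` vanishes on all of `L_v`. -/
theorem finrank_wedgeFiber_inf_lagrangian_eq_three_iff (hV : finrank ℂ V = 5)
    {γ : LinearMap.BilinForm ℂ W} (hγ : γ.IsSymm) (hS : IsStronglySmooth vol W γ 2) {v : V}
    (hv : v ≠ 0) :
    finrank ℂ (wedgeFiber ((v, 0) : V × ℂ) ⊓ lagrangian vol W γ :
      Submodule ℂ (⋀[ℂ]^3 (V × ℂ))) = 3 ↔ lineSpace W v ∈ linesIn (gmQuadrics vol W γ) := by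
  have : FiniteDimensional ℂ V := FiniteDimensional.of_finrank_pos (by omega)
  have h1 := finrank_ker_fiberDual vol W hV hS.finrank_eq hv
  have h2 := finrank_lineSpace_le vol W hV hS hv
  have hle : (fiberPairs vol W γ v).map (LinearMap.snd ℂ _ _) ≤ lineSpace W v :=
    fun w hw => ((mem_map_snd_fiberPairs vol W hV γ hv).1 hw).1
  have h3 := Submodule.finrank_mono hle
  have h0 := finrank_eq_map_snd_add_comap_inl (A := ⋀[ℂ]^3 V) (B := W) (fiberPairs vol W γ v)
  rw [finrank_comap_inl_fiberPairs] at h0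
  rw [finrank_wedgeFiber_inf_lagrangian vol W γ hv, mem_linesIn_iff vol W hV hγ, h0]
  constructor
  · intro h
    refine ⟨by omega, fun w hw w' hw' => ⟨mul_eq_zero_of_mem_lineSpace W hv hw hw', ?_⟩⟩
    have hge := le_of_le_of_finrank_le hle (by omega)
    exact ((mem_map_snd_fiberPairs vol W hV γ hv).1 (hge hw)).2 w' hw'
  · rintro ⟨h4, h5⟩
    have hge : lineSpace W v ≤ (fiberPairs vol W γ v).map (LinearMap.snd ℂ _ _) :=
      fun w hw => (mem_map_snd_fiberPairs vol W hV γ hv).2 ⟨hw, fun w' hw' => (h5 w hw w' hw').2⟩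
    have h6 := Submodule.finrank_mono hge
    omega

/-! ### From vectors `v` to points of `ℙ(V)`. -/

theorem rep_eq_of_mem_hyperplane {p : ℙ ℂ (V × ℂ)} (hp : p ∈ hyperplane V) :
    p.rep = (p.rep.1, 0) := by
  have h : p.rep ∈ LinearMap.range (LinearMap.inl ℂ V ℂ) := by
    apply hp
    rw [Projectivization.submodule_eq]
    exact Submodule.mem_span_singleton_self _
  obtain ⟨v, hv⟩ := h
  rw [← hv]
  rfl

theorem rep_fst_ne_zero {p : ℙ ℂ (V × ℂ)} (hp : p ∈ hyperplane V) : p.rep.1 ≠ 0 := by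
  intro h
  apply p.rep_nonzero
  rw [rep_eq_of_mem_hyperplane hp, h]
  rfl

theorem mem_epwStratum_iff (hV : finrank ℂ V = 5)
    {γ : LinearMap.BilinForm ℂ W} (hγ : γ.IsSymm) (hS : IsStronglySmooth vol W γ 2)
    {p : ℙ ℂ (V × ℂ)} (hp : p ∈ hyperplane V) : p ∈ epwStratum (lagrangian vol W γ) 3 ↔
      lineSpace W p.rep.1 ∈ linesIn (gmQuadrics vol W γ) := by
  rw [← finrank_wedgeFiber_inf_lagrangian_eq_three_iff vol W hV hγ hS (rep_fst_ne_zero hp),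
    ← rep_eq_of_mem_hyperplane hp]
  rfl

theorem lineSpace_smul {c : ℂ} (hc : c ≠ 0) (v : V) : lineSpace W (c • v) = lineSpace W v := by
  ext w
  rw [mem_lineSpace, mem_lineSpace, map_smul, smul_mul_assoc, smul_eq_zero, or_iff_right hc]

theorem eq_of_lineSpace_eq {p q : ℙ ℂ (V × ℂ)} (hp : p ∈ hyperplane V) (hq : q ∈ hyperplane V)
    (h : lineSpace W p.rep.1 = lineSpace W q.rep.1) (h2 : finrank ℂ (lineSpace W p.rep.1) = 2) :
    p = q := by
  have hdep : ¬ LinearIndependent ℂ ![q.rep.1, p.rep.1] := by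
    intro hind
    have := finrank_lineSpace_inf_le W hind
    rw [← h, inf_idem, h2] at this
    omega
  rw [LinearIndependent.pair_iff' (rep_fst_ne_zero hq)] at hdep
  push Not at hdep
  obtain ⟨a, ha⟩ := hdep
  rw [← p.mk_rep, ← q.mk_rep, Projectivization.mk_eq_mk_iff']
  refine ⟨a, ?_⟩
  rw [rep_eq_of_mem_hyperplane hp, rep_eq_of_mem_hyperplane hq, Prod.smul_mk, ha, smul_zero]

theorem exists_mem_hyperplane {v : V} (hv : v ≠ 0) :
    ∃ p ∈ hyperplane V, lineSpace W p.rep.1 = lineSpace W v := by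
  have hv' : ((v, 0) : V × ℂ) ≠ 0 := by simpa using hv
  refine ⟨Projectivization.mk ℂ (v, 0) hv', ?_, ?_⟩
  · rw [hyperplane, Set.mem_ofPred_eq, Projectivization.submodule_mk,
      Submodule.span_singleton_le_iff_mem]
    exact ⟨v, rfl⟩
  · obtain ⟨a, ha⟩ := Projectivization.exists_smul_eq_mk_rep ℂ ((v, 0) : V × ℂ) hv'
    rw [← ha]
    exact lineSpace_smul W a.ne_zero v

end Fiber

end GushelMukai

end

/-! ### The bijection `[v] ↦ L_v`. -/

theorem mainTheorem3 {V : Type*} [AddCommGroup V] [Module ℂ V]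
    (hV : Module.finrank ℂ V = 5) (vol : ⋀[ℂ]^5 V ≃ₗ[ℂ] ℂ)
    (W : Submodule ℂ (⋀[ℂ]^2 V)) (γ : LinearMap.BilinForm ℂ W) (hγ : γ.IsSymm)
    (hS : GushelMukai.IsStronglySmooth vol W γ 2) :
    Nonempty (↥(GushelMukai.epwStratum (GushelMukai.lagrangian vol W γ) 3 ∩
        GushelMukai.hyperplane V) ≃ ↥(GushelMukai.linesIn (GushelMukai.gmQuadrics vol W γ))) ∧
      (GushelMukai.linesIn (GushelMukai.gmQuadrics vol W γ) = ∅ →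
        GushelMukai.epwStratum (GushelMukai.lagrangian vol W γ) 3 ∩
          GushelMukai.hyperplane V = ∅) := by
  have e : Nonempty (↥(GushelMukai.epwStratum (GushelMukai.lagrangian vol W γ) 3 ∩
      GushelMukai.hyperplane V) ≃ ↥(GushelMukai.linesIn (GushelMukai.gmQuadrics vol W γ))) := by
    refine ⟨Equiv.ofBijective (fun p => ⟨GushelMukai.lineSpace W p.1.rep.1,
      (GushelMukai.mem_epwStratum_iff vol W hV hγ hS p.2.2).1 p.2.1⟩) ⟨?_, ?_⟩⟩
    · rintro ⟨p, hp⟩ ⟨q, hq⟩ h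
      have hp' := (GushelMukai.mem_epwStratum_iff vol W hV hγ hS hp.2).1 hp.1
      exact Subtype.ext (GushelMukai.eq_of_lineSpace_eq W hp.2 hq.2 (congrArg Subtype.val h) hp'.1)
    · rintro ⟨L, hL⟩
      obtain ⟨v, hv, rfl⟩ := GushelMukai.exists_lineSpace_eq vol W hV hγ hS hL
      obtain ⟨p, hp, h⟩ := GushelMukai.exists_mem_hyperplane W hv
      exact ⟨⟨p, (GushelMukai.mem_epwStratum_iff vol W hV hγ hS hp).2 (h ▸ hL), hp⟩,
        Subtype.ext h⟩
  refine ⟨e, fun h => ?_⟩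
  obtain ⟨e⟩ := e
  rw [Set.eq_empty_iff_forall_notMem]
  intro p hp
  exact Set.eq_empty_iff_forall_notMem.1 h _ (e ⟨p, hp⟩).2
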